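/- Let $\mathcal T$ be a triangulated category with shift $[1]$ that has arbitrary set-indexed coproducts; all subcategories are strict and full. For an object $T$ put $T^{\perp_{>0}}=\{Y : \mathrm{Hom}(T,Y[i])=0 \text{ for all } i>0\}$ and $T^{\perp_{\le 0}}=\{Y : \mathrm{Hom}(T,Y[i])=0 \text{ for all } i\le 0\}$. A t-structure is written as a pair $(\mathcal V,\mathcal W)$ with $\mathrm{Hom}(\mathcal V,\mathcal W)=0$, $\mathcal V[1]\subseteq\mathcal V$, and such that every object $X$ lies in a triangle $v(X)\to X\to w(X)\to v(X)[1]$ with $v(X)\in\mathcal V$ and $w(X)\in\mathcal W$ (both classes being closed under direct summands); $\mathcal V$ is called its aisle and $v(X)$, unique up to isomorphism, the truncation of $X$. The object $T$ is called silting if $(T^{\perp_{>0}},T^{\perp_{\le 0}})$ is a t-structure. Let $T$ be a silting object, with silting t-structure $(\mathcal V,\mathcal W)=(T^{\perp_{>0}},T^{\perp_{\le 0}})$. Then: 1. $\mathcal V=\mathsf{Susp}(T)$, the smallest subcategory of $\mathcal T$ that contains $T$ and is closed under extensions, positive shifts and coproducts; moreover, $\mathcal V$ is the smallest aisle of a t-structure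 in $\mathcal T$ that contains $T$. 2. For every object $X$ of $\mathcal T$ the truncation $v(X)$ is a Milnor colimit of a sequence $V_0\xrightarrow{f_1}V_1\xrightarrow{f_2}V_2\to\cdots$, where $V_0$ is a coproduct of copies of $T$ and, for each $n\ge 1$, the cone of $f_n: V_{n-1}\to V_n$ is a coproduct of copies of $T[n]$. Here a Milnor colimit of the sequence is a cone of the morphism $1-f:\coprod_{n\ge 0}V_n\to\coprod_{n\ge 0}V_n$, where $f$ sends the summand $V_{n-1}$ to $V_n$ by $f_n$. 3. Let $\mathcal U={}^{\perp_0}\mathcal V=\{Y : \mathrm{Hom}(Y,V)=0 \text{ for all } V\in\mathcal V\}$. Then $\mathcal U[1]\cap\mathcal V=\mathrm{Add}(T)$, the smallest subcategory of $\mathcal T$ that contains $T$ and is closed under coproducts and direct summands. -/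

import Mathlib

open CategoryTheory CategoryTheory.Limits CategoryTheory.Pretriangulated

universe v u

namespace Silting

section Basic

variable {C : Type u} [Category.{v} C] [Preadditive C] [HasZeroObject C] [HasShift C ℤ]
  [∀ n : ℤ, (shiftFunctor C n).Additive] [Pretriangulated C]

/-- The right orthogonal class of `P` for a set `I` of integers: all `Y` with
`Hom(X, Y[i]) = 0` for all `X` in `P` and all `i ∈ I`. -/
def rightPerp (P : ObjectProperty C) (I : Set ℤ) : ObjectProperty C :=
  fun Y => ∀ X : C, P X → ∀ i ∈ I, ∀ f : X ⟶ Y⟦i⟧, f = 0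

/-- The left orthogonal class of `P` for a set `I` of integers: all `Y` with
`Hom(Y, X[i]) = 0` for all `X` in `P` and all `i ∈ I`. -/
def leftPerp (P : ObjectProperty C) (I : Set ℤ) : ObjectProperty C :=
  fun Y => ∀ X : C, P X → ∀ i ∈ I, ∀ f : Y ⟶ X⟦i⟧, f = 0

/-- `(V, W)` is a t-structure, written as a pair (aisle, coaisle) with `Hom(V, W) = 0`.
In the cohomological indexing this is the pair of the classes `≤ 0` and `≥ 1`. -/
def IsTStructure (V W : ObjectProperty C) : Prop :=
  ∃ t : Triangulated.TStructure C, t.le 0 = V ∧ t.ge 1 = W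

/-- `V` is the aisle of some t-structure. -/
def IsAisle (V : ObjectProperty C) : Prop :=
  ∃ W : ObjectProperty C, IsTStructure V W

/-- The class of all `Y` with `Hom(T, Y[i]) = 0` for all `i > 0`. -/
def siltingAisle (T : C) : ObjectProperty C :=
  rightPerp (ObjectProperty.singleton T) (Set.Ioi 0)

/-- The class of all `Y` with `Hom(T, Y[i]) = 0` for all `i ≤ 0`. -/
def siltingCoaisle (T : C) : ObjectProperty C :=
  rightPerp (ObjectProperty.singleton T) (Set.Iic 0)

/-- `T` is a silting object. -/
def IsSilting (T : C) : Prop :=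
  IsTStructure (siltingAisle T) (siltingCoaisle T)

/-- A (strict, full) subcategory is suspended if it is closed under extensions and
positive shifts. -/
structure IsSuspended (P : ObjectProperty C) : Prop where
  closed_iso : P.IsClosedUnderIsomorphisms
  closed_ext : P.IsTriangulatedClosed₂
  closed_shift : ∀ n : ℤ, 0 < n → P.IsStableUnderShiftBy n

/-- A class of objects is closed under all existing set-indexed coproducts. -/
def IsClosedUnderCoproducts (P : ObjectProperty C) : Prop :=
  ∀ J : Type v, P.IsClosedUnderColimitsOfShape (Discrete J)

/-- The smallest suspended subcategory that contains `P` and is closed under all existing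
coproducts. -/
def susp (P : ObjectProperty C) : ObjectProperty C :=
  sInf {Q | IsSuspended Q ∧ IsClosedUnderCoproducts Q ∧ P ≤ Q}

/-- The smallest subcategory that contains `P` and is closed under coproducts and direct
summands. -/
def addClosure (P : ObjectProperty C) : ObjectProperty C :=
  sInf {Q | IsClosedUnderCoproducts Q ∧ Q.IsStableUnderRetracts ∧ P ≤ Q}

/-- `M` is a coproduct of a set-indexed family of copies of `S`. -/
def IsCoproductOfCopies (S M : C) : Prop :=
  ∃ (J : Type v) (c : Cofan fun _ : J => S), Nonempty (IsColimit c) ∧ Nonempty (c.pt ≅ M)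

/-- `M` is a Milnor colimit of `X 0 ⟶ X 1 ⟶ X 2 ⟶ ⋯`: a cone of the endomorphism
`1 - f` of the coproduct of all `X n`, where `f` sends `X n` to `X (n + 1)` by `f n`. -/
def IsMilnorColimit (X : ℕ → C) (f : ∀ n, X n ⟶ X (n + 1)) (M : C) : Prop :=
  ∃ (c : Cofan X) (hc : IsColimit c) (p : c.pt ⟶ M) (d : M ⟶ c.pt⟦(1 : ℤ)⟧),
    Triangle.mk (𝟙 c.pt - Cofan.IsColimit.desc hc fun n => f n ≫ c.inj (n + 1)) p d
      ∈ distTriang C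

/-- `A` is a truncation of `X` with respect to the aisle of `(V, W)`: it is the first term of a
triangle `A ⟶ X ⟶ B ⟶ A[1]` with `A` in `V` and `B` in `W`. If `(V, W)` is a
t-structure, then `A` is unique up to isomorphism and is the value at `X` of the right adjoint of
the inclusion of `V`. -/
def IsTruncation (V W : ObjectProperty C) (X A : C) : Prop :=
  V A ∧ ∃ (B : C) (f : A ⟶ X) (g : X ⟶ B) (h : B ⟶ A⟦(1 : ℤ)⟧),
    W B ∧ Triangle.mk f g h ∈ distTriang C

end Basic

end Silting

namespace Silting

/-! Everything rests on one approximation (`exists_approximation`). If `X` lies in degrees `≤ a`,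
map the coproduct of copies of `T[-a]` indexed by all morphisms `T[-a] ⟶ X` to `X`. The cone
receives no nonzero map from `T[-a]`, so it lies in degrees `≤ a - 1`, since `T` alone detects these
bounds.

Starting from `A` in the aisle and approximating successive cones, the octahedral axiom yields `Y 0
⟶ Y 1 ⟶ ⋯` over `A`, where the cone of `Y n ⟶ A` lies in degrees `≤ -(n + 1)`. For a bounded below
`W`, the groups `Hom(Y n, W)` stabilise at `Hom(A, W)` and have no derived limit, so the Milnor
colimit `M` satisfies `Hom(M, W) = Hom(A, W)`. Hence the cone of `M ⟶ A` lies in all degrees `≤ n`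
(`isLE_cone_of_milnor`). It then receives no map from any shift of `T`, so it lies in both aisle and
coaisle and vanishes.

Thus every object of the aisle, in particular every truncation, is built from `T` by coproducts,
positive shifts and extensions, which gives minimality. If `X` in the aisle has no maps to degrees
`≤ -1`, its first approximation splits, so `X` is a summand of a coproduct of copies of `T`. -/

/-- The derived limit of an eventually surjective inverse sequence of abelian groups vanishes. -/
lemma exists_sub_map_succ_eq {G : ℕ → Type*} [∀ n, AddCommGroup (G n)]
    (ρ : ∀ n, G (n + 1) →+ G n) (N : ℕ) (hρ : ∀ n, N ≤ n → Function.Surjective (ρ n))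
    (r : ∀ n, G n) : ∃ s : ∀ n, G n, ∀ n, s n - ρ n (s (n + 1)) = r n := by
  induction N generalizing G with
  | zero =>
    choose σ hσ using fun n => hρ n n.zero_le
    -- The start `0` is arbitrary; each later term is a preimage of `s n - r n`.
    let s : ∀ n, G n := fun n => Nat.rec 0 (fun n x => σ n (x - r n)) n
    refine ⟨s, fun n => ?_⟩
    change s n - ρ n (σ n (s n - r n)) = r n
    rw [hσ, sub_sub_cancel]
  | succ N ih =>
    obtain ⟨s, hs⟩ := ih (G := fun n => G (n + 1)) (fun n => ρ (n + 1))
      (fun n hn => hρ (n + 1) (Nat.succ_le_succ hn)) (fun n => r (n + 1))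
    -- The equation in degree `0` determines `s' 0` from `s' 1`, with no surjectivity needed.
    let s' : ∀ n, G n := fun n => Nat.casesOn n (r 0 + ρ 0 (s 0)) s
    refine ⟨s', fun n => ?_⟩
    cases n with
    | zero => exact add_sub_cancel_right _ _
    | succ n => exact hs n

/-! ### Coproducts and orthogonality -/

section

variable {C : Type u} [Category.{v} C]

/-- Closure under coproducts, for an index set in the universe of the morphisms up to
bijection. -/
lemma IsClosedUnderCoproducts.prop_pt {P : ObjectProperty C} (hP : IsClosedUnderCoproducts P)
    {β : Type*} [Small.{v} β] {X : β → C} {c : Cofan X} (hc : IsColimit c)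
    (hX : ∀ b, P (X b)) : P c.pt := by
  have := hP (Shrink.{v} β)
  have : P.IsClosedUnderColimitsOfShape (Discrete β) :=
    .of_equivalence (Discrete.equivalence (equivShrink.{v} β).symm)
  exact P.prop_of_isColimit hc fun j => hX j.as

lemma IsCoproductOfCopies.prop {P : ObjectProperty C} (hP : IsClosedUnderCoproducts P)
    [P.IsClosedUnderIsomorphisms] {S M : C} (h : IsCoproductOfCopies S M) (hS : P S) : P M := by
  obtain ⟨J, c, ⟨hc⟩, ⟨e⟩⟩ := h
  exact P.prop_of_iso e (hP.prop_pt hc fun _ => hS)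

end

section

variable {C : Type u} [Category.{v} C] [Preadditive C]

lemma comp_iso_eq_zero_iff {X Y Z : C} (u : X ⟶ Y) (e : Y ≅ Z) : u ≫ e.hom = 0 ↔ u = 0 := by
  rw [← cancel_mono e.hom, zero_comp]

lemma rightPerp_singleton_iff [HasShift C ℤ] (T : C) (I : Set ℤ) (Y : C) :
    rightPerp (ObjectProperty.singleton T) I Y ↔ ∀ i ∈ I, ∀ f : T ⟶ Y⟦i⟧, f = 0 := by
  simp [rightPerp]

end

section

variable {C : Type u} [Category.{v} C] [Preadditive C] [HasZeroObject C] [HasShift C ℤ]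
  [∀ n : ℤ, (shiftFunctor C n).Additive] [Pretriangulated C]

/-! ### Exactness for triangles given by their morphisms -/

section Exact

variable {X Y Z W : C} {f : X ⟶ Y} {g : Y ⟶ Z} {h : Z ⟶ X⟦(1 : ℤ)⟧}
  (hT : Triangle.mk f g h ∈ distTriang C)

include hT

lemma distTriang_comp_zero₁₂ : f ≫ g = 0 := comp_distTriang_mor_zero₁₂ _ hT

lemma distTriang_comp_zero₃₁ : h ≫ f⟦(1 : ℤ)⟧' = 0 := comp_distTriang_mor_zero₃₁ _ hT

lemma distTriang_exists_desc₂ (u : Y ⟶ W) (hu : f ≫ u = 0) : ∃ v : Z ⟶ W, u = g ≫ v :=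
  Triangle.yoneda_exact₂ _ hT u hu

lemma distTriang_exists_desc₃ (u : Z ⟶ W) (hu : g ≫ u = 0) :
    ∃ v : X⟦(1 : ℤ)⟧ ⟶ W, u = h ≫ v :=
  Triangle.yoneda_exact₃ _ hT u hu

lemma distTriang_exists_lift₂ (u : W ⟶ Y) (hu : u ≫ g = 0) : ∃ v : W ⟶ X, u = v ≫ f :=
  Triangle.coyoneda_exact₂ _ hT u hu

lemma distTriang_exists_lift₃ (u : W ⟶ Z) (hu : u ≫ h = 0) : ∃ v : W ⟶ Y, u = v ≫ g :=
  Triangle.coyoneda_exact₃ _ hT u hu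

end Exact

lemma distTriang_of_iso₃ {X Y Z Z' : C} {f : X ⟶ Y} {g : Y ⟶ Z} {h : Z ⟶ X⟦(1 : ℤ)⟧}
    (hT : Triangle.mk f g h ∈ distTriang C) (e : Z ≅ Z') :
    Triangle.mk f (g ≫ e.hom) (e.inv ≫ h) ∈ distTriang C :=
  isomorphic_distinguished _ hT _ <|
    Triangle.isoMk (Triangle.mk f (g ≫ e.hom) (e.inv ≫ h)) (Triangle.mk f g h)
      (Iso.refl X) (Iso.refl Y) e.symm
      ((Category.comp_id f).trans (Category.id_comp f).symm)
      (show (g ≫ e.hom) ≫ e.inv = 𝟙 Y ≫ g by simp)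
      (show (e.inv ≫ h) ≫ (𝟙 X)⟦(1 : ℤ)⟧' = e.inv ≫ h by simp)

/-! ### Aisles -/

section Aisle

variable (t : Triangulated.TStructure C)

lemma isClosedUnderCoproducts_le (n : ℤ) : IsClosedUnderCoproducts (t.le n) := by
  refine fun J => ⟨fun X ⟨p⟩ => ?_⟩
  rw [t.le_iff_isLE, t.isLE_iff_orthogonal n (n + 1) rfl]
  intro Y f _
  refine p.isColimit.hom_ext fun j => ?_
  have : t.IsLE (p.diag.obj j) n := ⟨p.prop_diag_obj j⟩
  rw [t.zero (p.ι.app j ≫ f) n (n + 1), comp_zero]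

lemma isStableUnderRetracts_le (n : ℤ) : (t.le n).IsStableUnderRetracts := by
  refine ⟨fun {X Y} r hY => ?_⟩
  rw [t.le_iff_isLE, t.isLE_iff_orthogonal n (n + 1) rfl]
  intro Z f _
  have : t.IsLE Y n := ⟨hY⟩
  rw [← Category.id_comp f, ← r.retract, Category.assoc, t.zero (r.r ≫ f) n (n + 1), comp_zero]

lemma isSuspended_le_zero : IsSuspended (t.le 0) where
  closed_iso := inferInstance
  closed_ext := .mk' fun T hT h₁ h₃ => (t.isLE₂ T hT 0 ⟨h₁⟩ ⟨h₃⟩).le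
  closed_shift n hn := ⟨fun X hX =>
    t.le_monotone (by lia : -n ≤ 0) _ (t.le_shift 0 n (-n) (by lia) X hX)⟩

variable {t}

lemma isLE₃ {X Y Z : C} {f : X ⟶ Y} {g : Y ⟶ Z} {h : Z ⟶ X⟦(1 : ℤ)⟧}
    (hT : Triangle.mk f g h ∈ distTriang C) (n : ℤ) (hY : t.IsLE Y n) (hX : t.IsLE X (n + 1)) :
    t.IsLE Z n :=
  t.isLE₂ _ (rot_of_distTriang _ hT) n hY (t.isLE_shift X (n + 1) 1 n)

/-- Morphisms to a bounded below object are determined by their restriction along a morphism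
whose cone is sufficiently negative. -/
lemma eq_zero_of_comp_eq_zero {X Y Z W : C} {f : X ⟶ Y} {g : Y ⟶ Z} {h : Z ⟶ X⟦(1 : ℤ)⟧}
    (hT : Triangle.mk f g h ∈ distTriang C) {k m : ℤ} (hkm : k < m) (hZ : t.IsLE Z k)
    (hW : t.IsGE W m) (u : Y ⟶ W) (hu : f ≫ u = 0) : u = 0 := by
  obtain ⟨v, rfl⟩ := distTriang_exists_desc₂ hT u hu
  rw [show v = 0 from t.zero_of_isLE_of_isGE v k m hkm hZ hW, comp_zero]

/-- Morphisms to a bounded below object extend along a morphism whose cone is sufficiently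
negative. -/
lemma exists_comp_eq {X Y Z W : C} {f : X ⟶ Y} {g : Y ⟶ Z} {h : Z ⟶ X⟦(1 : ℤ)⟧}
    (hT : Triangle.mk f g h ∈ distTriang C) {k m : ℤ} (hkm : k + 1 < m) (hZ : t.IsLE Z k)
    (hW : t.IsGE W m) (u : X ⟶ W) : ∃ v : Y ⟶ W, f ≫ v = u := by
  obtain ⟨v, hv⟩ := Triangle.yoneda_exact₂ _ (inv_rot_of_distTriang _ hT) u
    (t.zero_of_isLE_of_isGE _ (k + 1) m hkm (t.isLE_shift Z k (-1) (k + 1)) hW)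
  exact ⟨v, hv.symm⟩

end Aisle

/-! ### Milnor colimits -/

section Milnor

variable {t : Triangulated.TStructure C} {Y : ℕ → C} {f : ∀ n, Y n ⟶ Y (n + 1)} {A : C}
  {y : ∀ n, Y n ⟶ A}

/-- If the cones of the morphisms `Y n ⟶ A` become arbitrarily negative, then morphisms to a
bounded below object satisfy the vanishing of the derived limit. -/
lemma exists_sub_comp_eq (hy : ∀ n, f n ≫ y (n + 1) = y n)
    (hcone : ∀ n : ℕ, ∃ (Z : C) (g : A ⟶ Z) (h : Z ⟶ (Y n)⟦(1 : ℤ)⟧),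
      Triangle.mk (y n) g h ∈ distTriang C ∧ t.IsLE Z (-(n + 1)))
    {m : ℤ} {W : C} (hW : t.IsGE W m) (r : ∀ n, Y n ⟶ W) :
    ∃ s : ∀ n, Y n ⟶ W, ∀ n, s n - f n ≫ s (n + 1) = r n := by
  -- Extending a map from `Y n` to `A` needs `-(n + 1) + 1 < m`, that is `n ≥ 1 - m`; an extension
  -- to `A` restricts to one on `Y (n + 1)`.
  refine exists_sub_map_succ_eq (G := fun n => Y n ⟶ W)
    (fun n => Preadditive.leftComp W (f n)) (1 - m).toNat (fun n hn u => ?_) r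
  obtain ⟨Z, g, h, hT, hZ⟩ := hcone n
  obtain ⟨v, rfl⟩ := exists_comp_eq hT (by lia) hZ hW u
  exact ⟨y (n + 1) ≫ v, by simp [Preadditive.leftComp, ← hy n]⟩

lemma exists_extension_of_cofan {c : Cofan Y} (hc : IsColimit c) {M : C} {p : c.pt ⟶ M}
    {d : M ⟶ c.pt⟦(1 : ℤ)⟧}
    (hM : Triangle.mk (𝟙 c.pt - Cofan.IsColimit.desc hc fun n => f n ≫ c.inj (n + 1)) p d
      ∈ distTriang C)
    (hy : ∀ n, f n ≫ y (n + 1) = y n) :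
    ∃ φ : M ⟶ A, ∀ n, c.inj n ≫ p ≫ φ = y n := by
  obtain ⟨φ, hφ⟩ := distTriang_exists_desc₂ hM (Cofan.IsColimit.desc hc y)
    (Cofan.IsColimit.hom_ext hc _ _ fun n => by
      simp [Preadditive.sub_comp, Preadditive.comp_sub, hy])
  refine ⟨φ, fun n => ?_⟩
  rw [← hφ, Cofan.IsColimit.fac]

variable (hy : ∀ n, f n ≫ y (n + 1) = y n)
    (hcone : ∀ n : ℕ, ∃ (Z : C) (g : A ⟶ Z) (h : Z ⟶ (Y n)⟦(1 : ℤ)⟧),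
      Triangle.mk (y n) g h ∈ distTriang C ∧ t.IsLE Z (-(n + 1)))
    {c : Cofan Y} (hc : IsColimit c) {M : C} {p : c.pt ⟶ M}
    {d : M ⟶ c.pt⟦(1 : ℤ)⟧}
    (hM : Triangle.mk (𝟙 c.pt - Cofan.IsColimit.desc hc fun n => f n ≫ c.inj (n + 1)) p d
      ∈ distTriang C)
    {φ : M ⟶ A} (hφ : ∀ n, c.inj n ≫ p ≫ φ = y n)

include hcone hφ in
lemma eq_zero_of_milnor_comp_eq_zero {m : ℤ} {W : C} (hW : t.IsGE W m) (u : A ⟶ W)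
    (hu : φ ≫ u = 0) : u = 0 := by
  obtain ⟨Z, g, h, hT, hZ⟩ := hcone (-m).toNat
  refine eq_zero_of_comp_eq_zero hT (by lia) hZ hW u ?_
  rw [← hφ, Category.assoc, Category.assoc, hu, comp_zero, comp_zero]

include hy hcone hM in
-- The obstruction is a derived limit. Such a `u` factors through `d` via the shift of some `r' :
-- c.pt ⟶ W[-1]`; vanishing of the derived limit writes `r'` as `(1 - f) ≫ s`, and `d` followed by
-- the shift of `1 - f` is zero.
lemma eq_zero_of_inj_comp_eq_zero {m : ℤ} {W : C} (hW : t.IsGE W m) (u : M ⟶ W)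
    (hu : ∀ n, c.inj n ≫ p ≫ u = 0) : u = 0 := by
  obtain ⟨r, hr⟩ := distTriang_exists_desc₃ hM u
    (Cofan.IsColimit.hom_ext hc _ _ fun n => by rw [hu, comp_zero])
  have hW' : t.IsGE (W⟦(-1 : ℤ)⟧) (m + 1) := t.isGE_shift W m (-1) (m + 1)
  let e : W⟦(-1 : ℤ)⟧⟦(1 : ℤ)⟧ ≅ W := (shiftEquiv C (1 : ℤ)).counitIso.app W
  obtain ⟨r', hr'⟩ := (shiftFunctor C (1 : ℤ)).map_surjective (r ≫ e.inv)
  obtain ⟨s, hs⟩ := exists_sub_comp_eq hy hcone hW' fun n => c.inj n ≫ r'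
  have hr'' : (𝟙 c.pt - Cofan.IsColimit.desc hc fun n => f n ≫ c.inj (n + 1)) ≫
      Cofan.IsColimit.desc hc s = r' :=
    Cofan.IsColimit.hom_ext hc _ _ fun n => by
      simp [Preadditive.sub_comp, Preadditive.comp_sub, ← hs]
  have h₀ := distTriang_comp_zero₃₁ hM
  have : u ≫ e.inv = 0 := by
    rw [hr, Category.assoc, ← hr', ← hr'', Functor.map_comp, reassoc_of% h₀, zero_comp]
  rw [← cancel_mono e.inv, this, zero_comp]

include hy hcone hM hφ in
-- An extension to `A` chosen at one sufficiently late stage works at all stages: earlier ones by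
-- restriction, later ones because extensions to `A` are unique. Agreement on every `Y n` then
-- suffices by `eq_zero_of_inj_comp_eq_zero`.
lemma exists_milnor_comp_eq {m : ℤ} {W : C} (hW : t.IsGE W m) (u : M ⟶ W) :
    ∃ v : A ⟶ W, φ ≫ v = u := by
  have ext_hom (n : ℕ) (hn : (1 - m).toNat ≤ n) : ∃ v : A ⟶ W, y n ≫ v = c.inj n ≫ p ≫ u := by
    obtain ⟨Z, g, h, hT, hZ⟩ := hcone n
    exact exists_comp_eq hT (by lia) hZ hW _
  have hp (n : ℕ) : c.inj n ≫ p = f n ≫ c.inj (n + 1) ≫ p := by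
    have := c.inj n ≫= distTriang_comp_zero₁₂ hM
    simpa [Preadditive.sub_comp, Preadditive.comp_sub, sub_eq_zero] using this
  obtain ⟨v, hv⟩ := ext_hom _ le_rfl
  have down (w : A ⟶ W) (k n : ℕ) (h : y (n + k) ≫ w = c.inj (n + k) ≫ p ≫ u) :
      y n ≫ w = c.inj n ≫ p ≫ u := by
    induction k with
    | zero => exact h
    | succ k ih =>
      refine ih ?_
      have hp' := hp (n + k) =≫ u
      simp only [Category.assoc] at hp'
      rw [hp', ← hy, Category.assoc]
      exact congrArg (f (n + k) ≫ ·) h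
  have up (k : ℕ) : y ((1 - m).toNat + k) ≫ v = c.inj ((1 - m).toNat + k) ≫ p ≫ u := by
    obtain ⟨w, hw⟩ := ext_hom ((1 - m).toNat + k) (Nat.le_add_right _ _)
    obtain ⟨Z, g, h, hT, hZ⟩ := hcone (1 - m).toNat
    have : v - w = 0 := eq_zero_of_comp_eq_zero hT (by lia) hZ hW _ (by
      rw [Preadditive.comp_sub, hv, down w k _ hw, sub_self])
    rw [sub_eq_zero.1 this, hw]
  have all (n : ℕ) : y n ≫ v = c.inj n ≫ p ≫ u :=
    down v (1 - m).toNat n (by rw [add_comm]; exact up n)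
  refine ⟨v, sub_eq_zero.1 (eq_zero_of_inj_comp_eq_zero hy hcone hc hM hW _ fun n => ?_)⟩
  rw [Preadditive.comp_sub, Preadditive.comp_sub, sub_eq_zero, ← all n, ← hφ]
  simp

include hcone hφ hy hM in
/-- If the cones of the morphisms `Y n ⟶ A` become arbitrarily negative, then every cone of a
compatible morphism from the Milnor colimit of `Y` to `A` is arbitrarily negative. -/
lemma isLE_cone_of_milnor {D : C} {g : A ⟶ D} {h : D ⟶ M⟦(1 : ℤ)⟧}
    (hD : Triangle.mk φ g h ∈ distTriang C) (n : ℤ) : t.IsLE D n := by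
  rw [t.isLE_iff_orthogonal n (n + 1) rfl]
  intro W u hW
  have hgu : g ≫ u = 0 := eq_zero_of_milnor_comp_eq_zero hcone hφ hW _ (by
    rw [reassoc_of% distTriang_comp_zero₁₂ hD, zero_comp])
  obtain ⟨e, rfl⟩ := distTriang_exists_desc₃ hD u hgu
  have hW' : t.IsGE (W⟦(-1 : ℤ)⟧) (n + 1 + 1) := t.isGE_shift W (n + 1) (-1) (n + 1 + 1)
  let i : W⟦(-1 : ℤ)⟧⟦(1 : ℤ)⟧ ≅ W := (shiftEquiv C (1 : ℤ)).counitIso.app W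
  obtain ⟨e', he'⟩ := (shiftFunctor C (1 : ℤ)).map_surjective (e ≫ i.inv)
  -- Extending `e'` over `A` makes `u` factor through `h` followed by the shift of `φ`, which is
  -- zero.
  obtain ⟨v, rfl⟩ := exists_milnor_comp_eq hy hcone hc hM hφ hW' e'
  rw [← cancel_mono i.inv, Category.assoc, ← he', Functor.map_comp,
    reassoc_of% distTriang_comp_zero₃₁ hD, zero_comp, zero_comp]

end Milnor

/-! ### Silting objects -/

section Silting

variable {t : Triangulated.TStructure C} {T : C}

/-- A silting object lies in its aisle. -/
lemma isLE_zero_of_ge_one_eq (hge : t.ge 1 = siltingCoaisle T) :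
    t.IsLE T 0 := by
  obtain ⟨X, Y, hX, hY, f, g, h, hT⟩ := t.exists_triangle T 0 1 rfl
  rw [hge, siltingCoaisle, rightPerp_singleton_iff] at hY
  -- The coaisle condition at `i = 0` kills `T ⟶ Y`, so `T` is a retract of its truncation.
  have hg : g = 0 := (comp_iso_eq_zero_iff g ((shiftFunctorZero C ℤ).symm.app Y)).1
    (hY 0 (by simp) _)
  obtain ⟨s, hs⟩ := distTriang_exists_lift₂ hT (𝟙 T) (by rw [hg, comp_zero])
  have := isStableUnderRetracts_le t 0
  exact ⟨(t.le 0).prop_of_retract ⟨s, f, hs.symm⟩ hX⟩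

variable (t) in
/-- A morphism to `A` with cone in degrees at most `-(n + 1)`, a stage of the construction of `A`
as a Milnor colimit. -/
structure Stage (A : C) (n : ℕ) where
  /-- the source -/
  obj : C
  /-- the morphism to `A` -/
  hom : obj ⟶ A
  /-- the cone -/
  cone : C
  /-- the morphism from `A` to the cone -/
  toCone : A ⟶ cone
  /-- the connecting morphism -/
  connecting : cone ⟶ obj⟦(1 : ℤ)⟧
  distinguished : Triangle.mk hom toCone connecting ∈ distTriang C
  isLE : t.IsLE cone (-(n + 1))

variable (hle : t.le 0 = siltingAisle T)

include hle

lemma isLE_iff_hom_eq_zero (X : C) (a : ℤ) :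
    t.IsLE X a ↔ ∀ i : ℤ, a < i → ∀ f : T ⟶ X⟦i⟧, f = 0 := by
  rw [← t.isLE_shift_iff X a a 0, ← t.le_iff_isLE, hle, siltingAisle, rightPerp_singleton_iff]
  constructor
  · intro h i hi f
    let e := (shiftFunctorAdd' C a (i - a) i (by lia)).app X
    exact (comp_iso_eq_zero_iff f e).1 (h (i - a) (by simpa using hi) (f ≫ e.hom))
  · intro h i hi f
    let e := (shiftFunctorAdd' C a i (a + i) rfl).symm.app X
    exact (comp_iso_eq_zero_iff f e).1 (h (a + i) (by simpa using hi) (f ≫ e.hom))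

/-- Lowering the bound from `a` to `a - 1` adds only the condition at `i = a`. The isomorphism `e`
lets `S` be `T` or `T[n + 1]` itself instead of a shift by a double negative. -/
lemma isLE_of_hom_eq_zero {X S : C} {a : ℤ} (e : S ≅ T⟦-a⟧) (hX : t.IsLE X a)
    (h : ∀ f : S ⟶ X, f = 0) : t.IsLE X (a - 1) := by
  rw [isLE_iff_hom_eq_zero hle] at hX ⊢
  intro i hi f
  obtain hi | rfl : a < i ∨ a = i := by lia
  · exact hX i hi f
  · let e' : X⟦a⟧⟦-a⟧ ≅ X := (shiftEquiv C a).unitIso.symm.app X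
    have h₁ := h (e.hom ≫ f⟦-a⟧' ≫ e'.hom)
    rw [← cancel_epi e.inv, e.inv_hom_id_assoc, comp_zero, comp_iso_eq_zero_iff] at h₁
    exact (shiftFunctor C (-a)).map_injective (by rw [h₁, Functor.map_zero])

lemma hom_eq_zero_of_isLE {X S : C} {a : ℤ} (e : S ≅ T⟦-a⟧) (hX : t.IsLE X (a - 1))
    (f : S ⟶ X) : f = 0 := by
  rw [isLE_iff_hom_eq_zero hle] at hX
  let e' : T ≅ S⟦a⟧ := (shiftEquiv C (-a)).unitIso.app T ≪≫
    (shiftFunctor C (- -a)).mapIso e.symm ≪≫ eqToIso (by rw [neg_neg])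
  have h := hX a (by lia) (e'.hom ≫ f⟦a⟧')
  rw [← cancel_epi e'.inv, e'.inv_hom_id_assoc, comp_zero] at h
  exact (shiftFunctor C a).map_injective (by rw [h, Functor.map_zero])

/-- The approximation triangle of `X` by a coproduct of copies of `S ≅ T[-a]`. -/
lemma exists_approximation [HasCoproducts.{v} C] (hT : t.IsLE T 0) {X S : C} {a : ℤ}
    (e : S ≅ T⟦-a⟧) (hX : t.IsLE X a) :
    ∃ (K Z : C) (f : K ⟶ X) (g : X ⟶ Z) (h : Z ⟶ K⟦(1 : ℤ)⟧),
      Triangle.mk f g h ∈ distTriang C ∧ IsCoproductOfCopies S K ∧ t.IsLE Z (a - 1) := by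
  let p : (∐ fun _ : S ⟶ X => S) ⟶ X := Sigma.desc fun u => u
  obtain ⟨Z, g, h, hZ⟩ := distinguished_cocone_triangle p
  have hK : IsCoproductOfCopies S (∐ fun _ : S ⟶ X => S) :=
    ⟨S ⟶ X, _, ⟨coproductIsCoproduct _⟩, ⟨Iso.refl _⟩⟩
  have hS : t.IsLE S a :=
    have := t.isLE_shift T 0 (-a) a
    t.isLE_of_iso e.symm a
  have hKa : t.IsLE (∐ fun _ : S ⟶ X => S) a := ⟨hK.prop (isClosedUnderCoproducts_le t a) hS.le⟩
  refine ⟨_, Z, p, g, h, hZ, hK, isLE_of_hom_eq_zero hle e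
    (isLE₃ hZ a hX (t.isLE_of_le _ a (a + 1))) fun u => ?_⟩
  -- There are no nonzero maps from `S` to `K[1]`, so `u` lifts to `w : S ⟶ X`; this `w` is one of
  -- the indices of the coproduct, hence factors through `p` and dies in `Z`.
  obtain ⟨w, rfl⟩ := distTriang_exists_lift₃ hZ u
    (hom_eq_zero_of_isLE hle e (t.isLE_shift _ a 1 (a - 1)) _)
  have hw : w = Sigma.ι (fun _ : S ⟶ X => S) w ≫ p := by simp [p]
  rw [hw, Category.assoc, distTriang_comp_zero₁₂ hZ, comp_zero]

lemma Stage.exists_zero [HasCoproducts.{v} C] (hT : t.IsLE T 0) {A : C} (hA : t.IsLE A 0) :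
    ∃ s : Stage t A 0, IsCoproductOfCopies T s.obj := by
  obtain ⟨K, Z, f, g, h, hZ, hK, hZ'⟩ := exists_approximation hle hT
    ((shiftFunctorZero' C (-0 : ℤ) (by simp)).symm.app T) hA
  exact ⟨⟨K, f, Z, g, h, hZ, by simpa using hZ'⟩, hK⟩

/-- The next stage is the fibre of `A ⟶ s.cone ⟶ Z`, where `Z` is the cone of an approximation of
`s.cone`. The octahedral axiom identifies the cone of the transition map with the approximating
coproduct. -/
lemma Stage.exists_succ [IsTriangulated C] [HasCoproducts.{v} C] (hT : t.IsLE T 0) {A : C} {n : ℕ}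
    (s : Stage t A n) :
    ∃ (s' : Stage t A (n + 1)) (f : s.obj ⟶ s'.obj), f ≫ s'.hom = s.hom ∧
      ∃ (K : C) (g : s'.obj ⟶ K) (h : K ⟶ s.obj⟦(1 : ℤ)⟧),
        Triangle.mk f g h ∈ distTriang C ∧ IsCoproductOfCopies (T⟦(n + 1 : ℤ)⟧) K := by
  obtain ⟨K, Z, p, q, r, hZ, hK, hZ'⟩ := exists_approximation hle hT
    (S := T⟦(n + 1 : ℤ)⟧) (eqToIso (by rw [neg_neg])) s.isLE
  obtain ⟨Y, y, w, hY⟩ := distinguished_cocone_triangle₁ (s.toCone ≫ q)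
  let o := Triangulated.someOctahedron' (rfl : s.toCone ≫ q = s.toCone ≫ q) s.distinguished hZ hY
  refine ⟨⟨Y, y, Z, s.toCone ≫ q, w, hY, ?_⟩, o.m₁, o.comm₁, K, o.m₃, _, o.mem, hK⟩
  convert hZ' using 1
  push_cast
  ring

/-- Every object of the aisle is a Milnor colimit of successive extensions of coproducts of
positive shifts of `T`. -/
theorem exists_milnorColimit [IsTriangulated C] [HasCoproducts.{v} C] (hT : t.IsLE T 0)
    (hge : t.ge 1 = siltingCoaisle T) {A : C} (hA : t.IsLE A 0) :
    ∃ (Y : ℕ → C) (f : ∀ n, Y n ⟶ Y (n + 1)),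
      IsCoproductOfCopies T (Y 0) ∧
      (∀ n : ℕ, ∃ (K : C) (g : Y (n + 1) ⟶ K) (h : K ⟶ (Y n)⟦(1 : ℤ)⟧),
        Triangle.mk (f n) g h ∈ distTriang C ∧ IsCoproductOfCopies (T⟦(n + 1 : ℤ)⟧) K) ∧
      IsMilnorColimit Y f A := by
  obtain ⟨s₀, hs₀⟩ := Stage.exists_zero hle hT hA
  choose next f hf hcof using fun n (s : Stage t A n) => s.exists_succ hle hT
  let s : ∀ n, Stage t A n := fun n => Nat.rec s₀ next n
  refine ⟨fun n => (s n).obj, fun n => f n (s n), hs₀, fun n => hcof n (s n), ?_⟩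
  have : HasColimitsOfShape (Discrete ℕ) C :=
    hasColimitsOfShape_of_equivalence (Discrete.equivalence (Equiv.ulift.{v} (α := ℕ)))
  let c : Cofan fun n => (s n).obj := Cofan.mk _ (Sigma.ι fun n => (s n).obj)
  let hc : IsColimit c := coproductIsCoproduct _
  obtain ⟨M, p, d, hM⟩ := distinguished_cocone_triangle
    (𝟙 c.pt - Cofan.IsColimit.desc hc fun n => f n (s n) ≫ c.inj (n + 1))
  have hy (n : ℕ) : f n (s n) ≫ (s (n + 1)).hom = (s n).hom := hf n (s n)
  obtain ⟨φ, hφ⟩ := exists_extension_of_cofan (y := fun n => (s n).hom) hc hM hy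
  obtain ⟨D, g, h, hD⟩ := distinguished_cocone_triangle φ
  have hcone (n : ℕ) : ∃ (Z : C) (g : A ⟶ Z) (h : Z ⟶ (s n).obj⟦(1 : ℤ)⟧),
      Triangle.mk (s n).hom g h ∈ distTriang C ∧ t.IsLE Z (-(n + 1)) :=
    ⟨_, _, _, (s n).distinguished, (s n).isLE⟩
  have hDle := isLE_cone_of_milnor hy hcone hc hM hφ hD
  -- The bound `i - 1` on `D` rules out maps `T ⟶ D[i]`, for each `i`.
  have hDge : t.IsGE D 1 := ⟨by
    rw [hge, siltingCoaisle, rightPerp_singleton_iff]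
    exact fun i _ => (isLE_iff_hom_eq_zero hle D (i - 1)).1 (hDle _) i (by lia)⟩
  have hD₀ : t.IsLE D 0 := hDle 0
  have : IsIso φ := (Triangle.isZero₃_iff_isIso₁ _ hD).1 (t.isZero D 0 1)
  exact ⟨c, hc, _, _, distTriang_of_iso₃ hM (asIso φ)⟩

end Silting

/-! ### Minimality of the aisle -/

/-- A suspended class that is closed under coproducts contains the Milnor colimit of a sequence
of its objects. -/
lemma IsSuspended.prop_of_isMilnorColimit {P : ObjectProperty C} (hP : IsSuspended P)
    (hP' : IsClosedUnderCoproducts P) {Y : ℕ → C} {f : ∀ n, Y n ⟶ Y (n + 1)} {A : C}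
    (hY : ∀ n, P (Y n)) (hA : IsMilnorColimit Y f A) : P A := by
  obtain ⟨c, hc, p, d, hM⟩ := hA
  have := hP.closed_iso
  have := hP.closed_ext
  have := hP.closed_shift 1 one_pos
  have hcP : P c.pt := hP'.prop_pt hc hY
  -- After rotation, `A` is an extension of `c.pt[1]` by `c.pt`, so closure under cones is not
  -- needed.
  exact P.ext_of_isTriangulatedClosed₂ _ (rot_of_distTriang _ hM) hcP (P.le_shift 1 _ hcP)

/-- Both minimality claims reduce to this, because every aisle is suspended and closed under
coproducts. -/
lemma le_zero_le_of_isSuspended [IsTriangulated C] [HasCoproducts.{v} C]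
    {t : Triangulated.TStructure C} {T : C} (hle : t.le 0 = siltingAisle T)
    (hge : t.ge 1 = siltingCoaisle T) {P : ObjectProperty C} (hP : IsSuspended P)
    (hP' : IsClosedUnderCoproducts P) (hT : P T) : t.le 0 ≤ P := by
  intro A hA
  obtain ⟨Y, f, hY₀, hY, hA⟩ :=
    exists_milnorColimit hle (isLE_zero_of_ge_one_eq hge) hge (A := A) ⟨hA⟩
  have := hP.closed_iso
  have := hP.closed_ext
  refine hP.prop_of_isMilnorColimit hP' (fun n => ?_) hA
  induction n with
  | zero => exact hY₀.prop hP' hT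
  | succ n ih =>
    obtain ⟨K, g, h, hK, hK'⟩ := hY n
    have := hP.closed_shift (n + 1) (by lia)
    exact P.ext_of_isTriangulatedClosed₂ _ hK ih (hK'.prop hP' (P.le_shift _ _ hT))

lemma le_zero_eq_susp [IsTriangulated C] [HasCoproducts.{v} C]
    {t : Triangulated.TStructure C} {T : C} (hle : t.le 0 = siltingAisle T)
    (hge : t.ge 1 = siltingCoaisle T) : t.le 0 = susp (ObjectProperty.singleton T) := by
  apply le_antisymm
  · refine le_sInf ?_
    rintro P ⟨hP, hP', hT⟩
    exact le_zero_le_of_isSuspended hle hge hP hP' (hT T (by simp))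
  · refine sInf_le ⟨isSuspended_le_zero t, isClosedUnderCoproducts_le t 0, ?_⟩
    rw [ObjectProperty.singleton_le_iff]
    exact (isLE_zero_of_ge_one_eq hge).le

lemma isLeast_le_zero [IsTriangulated C] [HasCoproducts.{v} C]
    {t : Triangulated.TStructure C} {T : C} (hle : t.le 0 = siltingAisle T)
    (hge : t.ge 1 = siltingCoaisle T) :
    IsLeast {V' : ObjectProperty C | IsAisle V' ∧ V' T} (t.le 0) := by
  refine ⟨⟨⟨t.ge 1, t, rfl, rfl⟩, (isLE_zero_of_ge_one_eq hge).le⟩, ?_⟩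
  rintro _ ⟨⟨_, t', rfl, -⟩, hT⟩
  exact le_zero_le_of_isSuspended hle hge (isSuspended_le_zero t')
    (isClosedUnderCoproducts_le t' 0) hT

/-! ### The class `U[1] ∩ V` and `Add(T)` -/

/-- An object `X` lies in `U[1]`, for `U` the left orthogonal class of the aisle, if and only if
it has no nonzero morphisms to objects in degrees at most `-1`. -/
lemma leftPerp_shift_iff (t : Triangulated.TStructure C) (X : C) :
    (leftPerp (t.le 0) {0}).shift (-1 : ℤ) X ↔ ∀ Z : C, t.IsLE Z (-1) → ∀ f : X ⟶ Z, f = 0 := by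
  constructor
  · intro h Z hZ f
    have hZ' := (t.isLE_shift Z (-1) (-1) 0).le
    have := h _ hZ' 0 rfl (f⟦(-1 : ℤ)⟧' ≫ ((shiftFunctorZero C ℤ).symm.app _).hom)
    rw [comp_iso_eq_zero_iff] at this
    exact (shiftFunctor C (-1 : ℤ)).map_injective (by rw [this, Functor.map_zero])
  · rintro h Z hZ _ rfl f
    rw [← comp_iso_eq_zero_iff f ((shiftFunctorZero C ℤ).app Z)]
    let e : X⟦(-1 : ℤ)⟧⟦(1 : ℤ)⟧ ≅ X := (shiftEquiv C (1 : ℤ)).counitIso.app X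
    have hZ : t.IsLE Z 0 := ⟨hZ⟩
    have := h _ (t.isLE_shift Z 0 1 (-1))
      (e.inv ≫ (f ≫ ((shiftFunctorZero C ℤ).app Z).hom)⟦(1 : ℤ)⟧')
    rw [← cancel_epi e.hom, e.hom_inv_id_assoc, comp_zero] at this
    exact (shiftFunctor C (1 : ℤ)).map_injective (by rw [this, Functor.map_zero])

lemma leftPerp_shift_inf_eq_addClosure [HasCoproducts.{v} C]
    {t : Triangulated.TStructure C} {T : C} (hle : t.le 0 = siltingAisle T)
    (hge : t.ge 1 = siltingCoaisle T) :
    (leftPerp (t.le 0) {0}).shift (-1 : ℤ) ⊓ t.le 0 =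
      addClosure (ObjectProperty.singleton T) := by
  have hT := isLE_zero_of_ge_one_eq hge
  have e : T ≅ T⟦(-0 : ℤ)⟧ := (shiftFunctorZero' C (-0 : ℤ) (by simp)).symm.app T
  apply le_antisymm
  · refine le_sInf ?_
    rintro P ⟨hP, hP', hPT⟩ X ⟨hX, hX'⟩
    rw [leftPerp_shift_iff] at hX
    obtain ⟨K, Z, f, g, h, hZ, hK, hZ'⟩ := exists_approximation hle hT e ⟨hX'⟩
    -- `Z` lies in degrees `≤ -1`, so `g = 0` and the approximation `K ⟶ X` splits.
    obtain ⟨s, hs⟩ := distTriang_exists_lift₂ hZ (𝟙 X) (by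
      rw [hX Z (by simpa using hZ') g, comp_zero])
    exact P.prop_of_retract ⟨s, f, hs.symm⟩ (hK.prop hP (hPT T (by simp)))
  · refine sInf_le ⟨fun J => ⟨fun X ⟨p⟩ => ⟨?_, ?_⟩⟩, ⟨fun {X Y} r hY => ⟨?_, ?_⟩⟩, ?_⟩
    · rw [leftPerp_shift_iff]
      intro Z hZ f
      refine p.isColimit.hom_ext fun j => ?_
      rw [comp_zero]
      exact (leftPerp_shift_iff t _).1 (p.prop_diag_obj j).1 Z hZ _
    · have := isClosedUnderCoproducts_le t 0 J
      exact (t.le 0).prop_of_isColimit p.isColimit fun j => (p.prop_diag_obj j).2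
    · rw [leftPerp_shift_iff]
      intro Z hZ f
      rw [← Category.id_comp f, ← r.retract, Category.assoc,
        (leftPerp_shift_iff t _).1 hY.1 Z hZ (r.r ≫ f), comp_zero]
    · have := isStableUnderRetracts_le t 0
      exact (t.le 0).prop_of_retract r hY.2
    · rw [ObjectProperty.singleton_le_iff]
      refine ⟨(leftPerp_shift_iff t T).2 fun Z hZ f => ?_, hT.le⟩
      exact hom_eq_zero_of_isLE hle e (by simpa using hZ) f

end

end Silting

theorem mainTheorem8 {C : Type u} [Category.{v} C] [Preadditive C] [HasZeroObject C]
    [HasShift C ℤ] [∀ n : ℤ, (shiftFunctor C n).Additive] [Pretriangulated C]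
    [IsTriangulated C] [HasCoproducts.{v} C]
    (T : C) (hT : Silting.IsSilting T)
    (V W : ObjectProperty C)
    (hV : V = Silting.siltingAisle T) (hW : W = Silting.siltingCoaisle T) :
    -- the aisle is `Susp(T)`, and it is the smallest aisle that contains `T`
    (V = Silting.susp (ObjectProperty.singleton T) ∧
      IsLeast {V' : ObjectProperty C | Silting.IsAisle V' ∧ V' T} V) ∧
    -- truncations are Milnor colimits
    (∀ X A : C, Silting.IsTruncation V W X A →
      ∃ (Y : ℕ → C) (f : ∀ n, Y n ⟶ Y (n + 1)),
        Silting.IsCoproductOfCopies T (Y 0) ∧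
        (∀ n : ℕ, ∃ (K : C) (g : Y (n + 1) ⟶ K) (h : K ⟶ (Y n)⟦(1 : ℤ)⟧),
          Triangle.mk (f n) g h ∈ distTriang C ∧
          Silting.IsCoproductOfCopies (T⟦(n + 1 : ℤ)⟧) K) ∧
        Silting.IsMilnorColimit Y f A) ∧
    -- `U[1] ∩ V = Add(T)` for `U` the left orthogonal class of `V`
    (Silting.leftPerp V {0}).shift (-1 : ℤ) ⊓ V =
      Silting.addClosure (ObjectProperty.singleton T) := by
  subst hV hW
  obtain ⟨t, hle, hge⟩ := hT
  rw [← hle]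
  refine ⟨⟨Silting.le_zero_eq_susp hle hge, Silting.isLeast_le_zero hle hge⟩,
    fun X A hA => ?_, Silting.leftPerp_shift_inf_eq_addClosure hle hge⟩
  exact Silting.exists_milnorColimit hle (Silting.isLE_zero_of_ge_one_eq hge) hge ⟨hA.1⟩
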